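/- **Setting.** Let $\mathcal X$ be a data domain (e.g. $\{0,1\}^d$), let $\mathcal Q$ be a finite nonempty set of linear queries $q:\mathcal X\to[0,1]$, with $q(D)=\frac1{|D|}\sum_{x\in D}q(x)$ for a dataset $D$ and $q(A)=\sum_x q(x)A(x)$ for a distribution $A$, and let $\widehat D\in\mathcal X^m$ be a public dataset with support $\widehat{\mathcal X}$. Let $n,m,T\ge1$ and $\tilde\varepsilon>0$. The mechanism $\mathrm{PMW}^{\mathrm{Pub}}$ takes a private dataset $\widetilde D\in\mathcal X^n$ and works as follows. Let $\varepsilon_0=\tilde\varepsilon/\sqrt{2T}$ and let $A_0$ be the empirical distribution of $\widehat D$ on $\widehat{\mathcal X}$. For $t=1,\dots,T$: 1. *Select* $q_t\in\mathcal Q$ using the scores $u(q)=|q(A_{t-1})-q(\widetilde D)|$, by either (the same choice in all rounds) the exponential mechanism, $\Pr[q_t=q]\propto\exp(\frac{\varepsilon_0 n}2u(q))$, or the permute-and-flip mechanism: go through $\mathcal Q$ in a uniformly random order, accept each $q$ independently with probability $\exp(\frac{\varepsilon_0n}2(u(q)-\max_{\mathcal Q}u))$, and return the first accepted query. 2. *Measure:*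 let $a_t$ be $q_t(\widetilde D)+\mathcal N(0,\frac1{n^2\varepsilon_0^2})$, truncated to $[0,1]$. 3. *Update:* let $A_t$ be the distribution on $\widehat{\mathcal X}$ with $A_t(x)\propto A_{t-1}(x)\exp\big(q_t(x)(a_t-q_t(A_{t-1}))/2\big)$. The output is $A=\frac1T\sum_{t=1}^TA_{t-1}$. Datasets in $\mathcal X^n$ are neighbouring if one is obtained from the other by changing one individual's record. A mechanism $M$ is *$\rho$-concentrated differentially private* if $\mathrm D_\alpha(M(D)\|M(D'))\le\rho\,\alpha$ for all neighbouring $D,D'$ and all $\alpha\in(1,\infty)$, where $\mathrm D_\alpha(\mu\|\nu)=\frac1{\alpha-1}\log\int(\frac{d\mu}{d\nu})^\alpha d\nu$ (and $=\infty$ if $\mu\not\ll\nu$) is the Rényi divergence. It is *$(\varepsilon,\delta)$-differentially private* if $\Pr[M(D)\in E]\le e^{\varepsilon}\Pr[M(D')\in E]+\delta$ for all neighbouring $D,D'$ and all events $E$. **Theorem.** With either selection rule, $\mathrm{PMW}^{\mathrm{Pub}}$ with privacy parameter $\tilde\varepsilon>0$ satisfies $\frac12\tilde\varepsilon^2$-concentrated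 differential privacy. Moreover, for every $\delta>0$ it satisfies $(\varepsilon(\delta),\delta)$-differential privacy, where $$\varepsilon(\delta)=\inf_{\alpha>1}\left[\tfrac12\tilde\varepsilon^2\alpha+\frac{\log(1/(\alpha\delta))}{\alpha-1}+\log\left(1-\tfrac1\alpha\right)\right]\in[-\infty,\infty)$$ (with $e^{-\infty}=0$; the value $-\infty$ occurs only for $\delta\ge1$), and for all $0<\delta\le1$ $$\varepsilon(\delta)\le\tfrac12\tilde\varepsilon^2+\tilde\varepsilon\sqrt{2\log(1/\delta)}.$$ -/

import Mathlib

open MeasureTheory ProbabilityTheory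
open scoped ENNReal NNReal

namespace PMWPub

/-! ### Neighbouring datasets, Rényi divergence, concentrated and approximate DP -/

/-- Two datasets of `n` records are neighbouring if one is obtained from the other by changing
the data of (at most) one individual. -/
def Neighboring {X : Type*} {n : ℕ} (D D' : Fin n → X) : Prop :=
  ∃ i, ∀ j, j ≠ i → D j = D' j

/-- Rényi divergence of order `α ∈ (1, ∞)`:
`(α - 1)⁻¹ log ∫ (dμ/dν)^α dν` if `μ ≪ ν`, and `∞` otherwise. -/
noncomputable def renyiDiv {R : Type*} [MeasurableSpace R] (α : ℝ) (μ ν : Measure R) : EReal :=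
  open Classical in
  if μ ≪ ν then
    (((α - 1)⁻¹ : ℝ) : EReal) * ENNReal.log (∫⁻ x, (μ.rnDeriv ν x) ^ α ∂ν)
  else ⊤

/-- `ρ`-concentrated differential privacy of a randomized mechanism, given by its output laws. -/
def IsCDP {X R : Type*} [MeasurableSpace R] {n : ℕ}
    (M : (Fin n → X) → ProbabilityMeasure R) (ρ : ℝ) : Prop :=
  ∀ D D' : Fin n → X, Neighboring D D' → ∀ α : ℝ, 1 < α →
    renyiDiv α (M D : Measure R) (M D' : Measure R) ≤ ((ρ * α : ℝ) : EReal)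

/-- `(ε, δ)`-differential privacy. The parameter `ε` may be `-∞`, with `e^(-∞) = 0`. -/
def IsDP {X R : Type*} [MeasurableSpace R] {n : ℕ}
    (M : (Fin n → X) → ProbabilityMeasure R) (ε : EReal) (δ : ℝ) : Prop :=
  ∀ D D' : Fin n → X, Neighboring D D' → ∀ E : Set R, MeasurableSet E →
    (M D : Measure R) E ≤ EReal.exp ε * (M D' : Measure R) E + ENNReal.ofReal δ

/-- `ε(δ) = inf_{α > 1} ½ ε̃² α + log (1 / (α δ)) / (α - 1) + log (1 - 1 / α)`. -/
noncomputable def epsOfDelta (εt δ : ℝ) : EReal :=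
  ⨅ α ∈ Set.Ioi (1 : ℝ),
    ((1 / 2 * εt ^ 2 * α + Real.log (1 / (α * δ)) / (α - 1) + Real.log (1 - 1 / α) : ℝ) : EReal)

/-! ### Selection mechanisms on a finite set of candidates -/

section Selection

variable {R : Type*} [Fintype R] [Nonempty R]

/-- The exponential mechanism: `Pr[r] ∝ exp (η * u r)`. -/
noncomputable def exponentialMechanism (η : ℝ) (u : R → ℝ) : PMF R :=
  PMF.ofFintype
    (fun r => ENNReal.ofReal (Real.exp (η * u r) / ∑ s, Real.exp (η * u s)))
    (by
      have hpos : 0 < ∑ s, Real.exp (η * u s) :=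
        Finset.sum_pos (fun s _ => Real.exp_pos _) Finset.univ_nonempty
      rw [← ENNReal.ofReal_sum_of_nonneg (fun r _ => by positivity), ← Finset.sum_div,
        div_self hpos.ne', ENNReal.ofReal_one])

/-- The maximal score. -/
noncomputable def maxScore (u : R → ℝ) : ℝ := Finset.univ.sup' Finset.univ_nonempty u

/-- The acceptance probability `exp (η * (u r - max u))` of a candidate. -/
noncomputable def acceptProb (η : ℝ) (u : R → ℝ) (r : R) : ℝ :=
  Real.exp (η * (u r - maxScore u))

lemma acceptProb_le_one {η : ℝ} (hη : 0 ≤ η) (u : R → ℝ) (r : R) : acceptProb η u r ≤ 1 := by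
  unfold acceptProb maxScore
  rw [Real.exp_le_one_iff]
  have := Finset.le_sup' u (Finset.mem_univ r)
  nlinarith

lemma exists_acceptProb_eq_one (η : ℝ) (u : R → ℝ) : ∃ r, acceptProb η u r = 1 := by
  obtain ⟨r, -, hr⟩ := Finset.exists_mem_eq_sup' (Finset.univ_nonempty (α := R)) u
  exact ⟨r, by simp [acceptProb, maxScore, hr]⟩

/-- Go through the candidates in the order `σ`, flip for each a coin with its acceptance
probability, and return the first accepted one. The candidate `r` is the first accepted one with
probability `p r * ∏ (1 - p s)`, over all `s` that precede `r`; some candidate is accepted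
for certain, since a candidate of maximal score has `p r = 1`. -/
noncomputable def firstAccepted {η : ℝ} (hη : 0 ≤ η) (u : R → ℝ)
    (σ : R ≃ Fin (Fintype.card R)) : PMF R :=
  PMF.ofFintype
    (fun r => ENNReal.ofReal
      (acceptProb η u r * ∏ s with σ s < σ r, (1 - acceptProb η u s)))
    (by
      have h0 : ∀ r, 0 ≤ acceptProb η u r := fun r => (Real.exp_pos _).le
      rw [← ENNReal.ofReal_sum_of_nonneg (fun r _ => mul_nonneg (h0 r)
        (Finset.prod_nonneg fun s _ => sub_nonneg.2 (acceptProb_le_one hη u s)))]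
      have key := @Finset.prod_one_sub_ordered R ℝ _ (LinearOrder.lift' σ σ.injective)
        Finset.univ (acceptProb η u)
      obtain ⟨r, hr⟩ := exists_acceptProb_eq_one η u
      rw [Finset.prod_eq_zero (Finset.mem_univ r) (by rw [hr, sub_self])] at key
      rw [← ENNReal.ofReal_one]
      congr 1
      exact (sub_eq_zero.1 key.symm).symm)

open Classical in
/-- The permute-and-flip mechanism: `firstAccepted` along a uniformly random order. -/
noncomputable def permuteAndFlip {η : ℝ} (hη : 0 ≤ η) (u : R → ℝ) : PMF R :=
  haveI : Nonempty (R ≃ Fin (Fintype.card R)) := ⟨Fintype.equivFin R⟩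
  (PMF.uniformOfFintype (R ≃ Fin (Fintype.card R))).bind (firstAccepted hη u)

/-- The two ways in which the algorithm may select queries. -/
inductive SelectionRule
  | exponential
  | permuteAndFlip

/-- The law of the selected candidate. -/
noncomputable def select (rule : SelectionRule) {η : ℝ} (hη : 0 ≤ η) (u : R → ℝ) : PMF R :=
  match rule with
  | .exponential => exponentialMechanism η u
  | .permuteAndFlip => permuteAndFlip hη u

lemma measurable_select (rule : SelectionRule) {η : ℝ} (hη : 0 ≤ η) (r : R) :
    Measurable fun u : R → ℝ => select rule hη u r := by
  have hm : Measurable fun u : R → ℝ => maxScore u := by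
    have : Continuous fun u : R → ℝ => maxScore u :=
      Continuous.finset_sup'_apply _ fun i _ => continuous_apply i
    exact this.measurable
  have ha : ∀ s : R, Measurable fun u : R → ℝ => acceptProb η u s := fun s => by
    unfold acceptProb
    fun_prop
  cases rule with
  | exponential =>
    simp only [select, exponentialMechanism, PMF.ofFintype_apply]
    fun_prop
  | permuteAndFlip =>
    classical
    simp only [select, permuteAndFlip, PMF.bind_apply, tsum_fintype, firstAccepted,
      PMF.ofFintype_apply]
    refine Finset.measurable_sum _ fun σ _ => Measurable.const_mul ?_ _
    refine ENNReal.measurable_ofReal.comp ((ha r).mul ?_)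
    exact Finset.measurable_prod _ fun s _ => (ha s).const_sub 1

end Selection

/-! ### The algorithm -/

section Algorithm

variable {X : Type*}

/-- Value of the linear query `q` on a dataset. -/
noncomputable def queryData {n : ℕ} (q : X → unitInterval) (D : Fin n → X) : ℝ :=
  (∑ i, (q (D i) : ℝ)) / n

/-- The distributions on a finite set `S` of records, as weight functions. -/
abbrev Dist (S : Finset X) : Type _ := stdSimplex ℝ S

/-- Value of the linear query `q` on a distribution. -/
noncomputable def queryDist {S : Finset X} (q : X → unitInterval) (A : Dist S) : ℝ :=
  ∑ x : S, (q x : ℝ) * A.1 x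

/-- The support of the public dataset. -/
def pubSupport [DecidableEq X] {m : ℕ} (Dhat : Fin m → X) : Finset X := Finset.univ.image Dhat

/-- The distribution on its support given by the (nonempty) public dataset. -/
noncomputable def empirical [DecidableEq X] {m : ℕ} (hm : 0 < m) (Dhat : Fin m → X) :
    Dist (pubSupport Dhat) :=
  ⟨fun x => (Finset.univ.filter fun i => Dhat i = x).card / (m : ℝ), fun x => by positivity, by
    have h : ∑ x : pubSupport Dhat, (Finset.univ.filter fun i => Dhat i = x).card = m := by
      rw [Finset.sum_coe_sort (pubSupport Dhat)
        (fun x => (Finset.univ.filter fun i => Dhat i = x).card)]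
      unfold pubSupport
      rw [← Finset.card_eq_sum_card_fiberwise (f := Dhat)
        (fun i _ => Finset.mem_image_of_mem _ (Finset.mem_univ i))]
      simp
    rw [← Finset.sum_div, ← Nat.cast_sum, h, div_self (by positivity)]⟩

/-- The noisy measurement `v + noise`, truncated to `[0,1]`. -/
noncomputable def clamp (a : ℝ) : ℝ := max 0 (min 1 a)

/-- The unnormalized weights of the multiplicative weights update. -/
noncomputable def mwWeight {S : Finset X} (q : X → unitInterval) (A : Dist S) (a : ℝ) (x : S) : ℝ :=
  A.1 x * Real.exp ((q x : ℝ) * (a - queryDist q A) / 2)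

lemma sum_mwWeight_pos {S : Finset X} (q : X → unitInterval) (A : Dist S) (a : ℝ) :
    0 < ∑ x, mwWeight q A a x := by
  have h0 : ∀ x, 0 ≤ mwWeight q A a x := fun x => mul_nonneg (A.2.1 x) (Real.exp_pos _).le
  refine lt_of_le_of_ne (Finset.sum_nonneg fun x _ => h0 x) fun h => ?_
  have h1 := (Finset.sum_eq_zero_iff_of_nonneg fun x _ => h0 x).1 h.symm
  have h2 : ∑ x, A.1 x = 0 := Finset.sum_eq_zero fun x hx => by
    simpa [mwWeight, (Real.exp_pos _).ne'] using h1 x hx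
  rw [A.2.2] at h2
  exact one_ne_zero h2

/-- The multiplicative weights update: `A'(x) ∝ A(x) exp (q(x) (a - q(A)) / 2)`. -/
noncomputable def mwUpdate {S : Finset X} (q : X → unitInterval) (A : Dist S) (a : ℝ) : Dist S :=
  ⟨fun x => mwWeight q A a x / ∑ y, mwWeight q A a y,
    fun x => div_nonneg (mul_nonneg (A.2.1 x) (Real.exp_pos _).le) (sum_mwWeight_pos q A a).le,
    by rw [← Finset.sum_div, div_self (sum_mwWeight_pos q A a).ne']⟩

lemma measurable_queryDist {S : Finset X} (q : X → unitInterval) :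
    Measurable fun A : Dist S => queryDist q A := by
  refine Finset.measurable_sum _ fun x _ => Measurable.const_mul ?_ _
  exact (measurable_pi_apply x).comp measurable_subtype_coe

lemma measurable_mwUpdate {S : Finset X} (q : X → unitInterval) :
    Measurable fun p : Dist S × ℝ => mwUpdate q p.1 p.2 := by
  have hw : ∀ x : S, Measurable fun p : Dist S × ℝ => mwWeight q p.1 p.2 x := fun x => by
    have h1 : Measurable fun p : Dist S × ℝ => queryDist q p.1 :=
      (measurable_queryDist (S := S) q).comp measurable_fst
    have h2 : Measurable fun p : Dist S × ℝ => p.1.1 x :=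
      (measurable_pi_apply x).comp (measurable_subtype_coe.comp measurable_fst)
    exact h2.mul (((measurable_snd.sub h1).const_mul _).div_const _).exp
  refine Measurable.subtype_mk (measurable_pi_iff.2 fun x => ?_)
  exact (hw x).div (Finset.measurable_sum _ fun y _ => hw y)

lemma measurable_mwUpdate_right {S : Finset X} (q : X → unitInterval) (A : Dist S) :
    Measurable (mwUpdate q A) :=
  (measurable_mwUpdate q).comp measurable_prodMk_left

lemma measurable_clamp : Measurable clamp := by
  unfold clamp
  fun_prop

/-- `ε₀ = ε̃ / √(2T)`. -/
noncomputable def epsZero (εt : ℝ) (T : ℕ) : ℝ := εt / √(2 * T)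

lemma epsZero_nonneg {εt : ℝ} (h : 0 < εt) (T : ℕ) : 0 ≤ epsZero εt T := by
  unfold epsZero
  positivity

/-- The law of the query selected when the current distribution is `A`: one of the two selection
mechanisms, with exponent `(ε₀ n / 2) |q(A) - q(D)|`. -/
noncomputable def selectQuery (rule : SelectionRule) {n : ℕ} {Q : Finset (X → unitInterval)}
    (hQ : Q.Nonempty) {ε₀ : ℝ} (hε : 0 ≤ ε₀) (D : Fin n → X) {S : Finset X} (A : Dist S) :
    PMF Q :=
  haveI : Nonempty Q := hQ.to_subtype
  select rule (η := ε₀ * n / 2) (by positivity)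
    (fun q : Q => |queryDist q.1 A - queryData q.1 D|)

/-- The law of the measurement of `q`: Gaussian noise of variance `1 / (n² ε₀²)` is added to the
true answer, and the result is truncated to `[0,1]`. -/
noncomputable def measureQuery {n : ℕ} (ε₀ : ℝ) (D : Fin n → X) (q : X → unitInterval) : Measure ℝ :=
  (gaussianReal (queryData q D) (Real.toNNReal (1 / ((n : ℝ) ^ 2 * ε₀ ^ 2)))).map clamp

instance {n : ℕ} (ε₀ : ℝ) (D : Fin n → X) (q : X → unitInterval) :
    IsProbabilityMeasure (measureQuery ε₀ D q) :=
  Measure.isProbabilityMeasure_map measurable_clamp.aemeasurable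

/-- One iteration, as a Markov kernel from `A_{t-1}` to `A_t`: sample a query, measure it,
update. -/
noncomputable def stepKernel (rule : SelectionRule) {n : ℕ} {Q : Finset (X → unitInterval)}
    (hQ : Q.Nonempty) {ε₀ : ℝ} (hε : 0 ≤ ε₀) (D : Fin n → X) (S : Finset X) :
    Kernel (Dist S) (Dist S) where
  toFun A := ∑ q : Q, selectQuery rule hQ hε D A q • (measureQuery ε₀ D q.1).map (mwUpdate q.1 A)
  measurable' := by
    have : Nonempty Q := hQ.to_subtype
    refine Measure.measurable_of_measurable_coe _ fun B hB => ?_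
    simp only [Measure.coe_finsetSum, Measure.smul_apply, Finset.sum_apply, smul_eq_mul]
    refine Finset.measurable_sum _ fun q _ => Measurable.mul ?_ ?_
    · refine (measurable_select rule _ q).comp (measurable_pi_iff.2 fun q' => ?_)
      exact ((measurable_queryDist q'.1).sub_const _).abs
    · have h : ∀ A : Dist S, (measureQuery ε₀ D q.1).map (mwUpdate q.1 A) B =
          measureQuery ε₀ D q.1
            (Prod.mk A ⁻¹' ((fun p : Dist S × ℝ => mwUpdate q.1 p.1 p.2) ⁻¹' B)) := fun A => by
        rw [Measure.map_apply (measurable_mwUpdate_right q.1 A) hB]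
        rfl
      simp only [h]
      exact measurable_measure_prodMk_left (measurable_mwUpdate q.1 hB)

instance (rule : SelectionRule) {n : ℕ} {Q : Finset (X → unitInterval)} (hQ : Q.Nonempty) {ε₀ : ℝ}
    (hε : 0 ≤ ε₀) (D : Fin n → X) (S : Finset X) :
    IsMarkovKernel (stepKernel rule hQ hε D S) where
  isProbabilityMeasure A := ⟨by
    have h : ∀ q : Q, (measureQuery ε₀ D q.1).map (mwUpdate q.1 A) Set.univ = 1 := fun q => by
      have := Measure.isProbabilityMeasure_map (μ := measureQuery ε₀ D q.1)
        (measurable_mwUpdate_right q.1 A).aemeasurable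
      exact measure_univ
    change (∑ q : Q, selectQuery rule hQ hε D A q •
      (measureQuery ε₀ D q.1).map (mwUpdate q.1 A)) Set.univ = 1
    simp only [Measure.coe_finsetSum, Measure.smul_apply, Finset.sum_apply, smul_eq_mul, h,
      mul_one]
    exact (tsum_fintype _).symm.trans (PMF.tsum_coe _)⟩

lemma measurable_snoc {Y : Type*} [MeasurableSpace Y] (t : ℕ) :
    Measurable fun p : (Fin (t + 1) → Y) × Y => (Fin.snoc p.1 p.2 : Fin (t + 2) → Y) := by
  refine measurable_pi_iff.2 fun i => ?_
  refine Fin.lastCases ?_ (fun j => ?_) i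
  · simpa using measurable_snd
  · simp only [Fin.snoc_castSucc]
    fun_prop

/-- The joint law of `(A_0, …, A_t)` when the algorithm starts at `A₀` and iterates the kernel
`κ`. -/
noncomputable def trajLaw {Y : Type*} [MeasurableSpace Y] (κ : Kernel Y Y) (A₀ : Y) :
    (t : ℕ) → Measure (Fin (t + 1) → Y)
  | 0 => Measure.dirac fun _ => A₀
  | t + 1 =>
    (trajLaw κ A₀ t ⊗ₘ κ.comap (fun h => h (Fin.last t)) (measurable_pi_apply _)).map
      fun p => (Fin.snoc p.1 p.2 : Fin (t + 2) → Y)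

instance {Y : Type*} [MeasurableSpace Y] (κ : Kernel Y Y) [IsMarkovKernel κ] (A₀ : Y) (t : ℕ) :
    IsProbabilityMeasure (trajLaw κ A₀ t) := by
  induction t with
  | zero => exact Measure.dirac.isProbabilityMeasure
  | succ t ih => exact Measure.isProbabilityMeasure_map (measurable_snoc t).aemeasurable

/-- The average of the first `T` distributions `A_0, …, A_{T-1}` of a trajectory. -/
noncomputable def average {S : Finset X} {T : ℕ} (hT : 0 < T) (h : Fin (T + 1) → Dist S) :
    Dist S :=
  ⟨fun x => (∑ t : Fin T, (h t.castSucc).1 x) / T,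
    fun x => div_nonneg (Finset.sum_nonneg fun t _ => (h t.castSucc).2.1 x) (by positivity), by
      have hs : ∀ t : Fin T, ∑ x, (h t.castSucc).1 x = 1 := fun t => (h t.castSucc).2.2
      rw [← Finset.sum_div, Finset.sum_comm]
      simp only [hs, Finset.sum_const, Finset.card_univ, Fintype.card_fin, nsmul_eq_mul, mul_one]
      exact div_self (by positivity)⟩

lemma measurable_average {S : Finset X} {T : ℕ} (hT : 0 < T) :
    Measurable (average (S := S) hT) := by
  refine Measurable.subtype_mk (measurable_pi_iff.2 fun x => ?_)
  refine (Finset.measurable_sum _ fun t _ => ?_).div_const _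
  exact (measurable_pi_apply x).comp (measurable_subtype_coe.comp (measurable_pi_apply _))

/-- The mechanism PMW^Pub with privacy parameter `εt`, `T` iterations, query class `Q` and public
dataset `Dhat`: it maps a private dataset to the law of the output distribution. -/
noncomputable def pmwPub [DecidableEq X] (rule : SelectionRule) {n m T : ℕ} (hm : 0 < m)
    (hT : 0 < T) (Dhat : Fin m → X) {Q : Finset (X → unitInterval)} (hQ : Q.Nonempty) {εt : ℝ}
    (hεt : 0 < εt) (D : Fin n → X) : ProbabilityMeasure (Dist (pubSupport Dhat)) :=
  ⟨(trajLaw (stepKernel rule hQ (epsZero_nonneg hεt T) D (pubSupport Dhat))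
      (empirical hm Dhat) T).map (average hT),
    Measure.isProbabilityMeasure_map (measurable_average hT).aemeasurable⟩

end Algorithm

end PMWPub

/-! Every privacy statement is carried by one relation, `HolderDominated`: the bound on the `α`-th
moment of the likelihood ratio, written through test functions. In this form no density has to be
produced or shown jointly measurable. Post-processing by `g` is testing with `f ∘ g`, adaptive
composition is Fubini applied twice (`compProd`), and constants multiply. Testing with a power of
`dP/dQ` returns the Rényi bound; testing with an indicator and then using weighted AM-GM returns
approximate privacy.

Each round costs `ε₀²`. Selection has likelihood ratios in `[e^(-ε₀), e^ε₀]`, which costs `ε₀²/2` by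
convexity and a comparison of hyperbolic cosines (`sum_mul_ratio_rpow_le`). The Gaussian
measurement, with noise `1/(n ε₀)` against sensitivity `1/n`, costs another `ε₀²/2`. The update, the
truncation and the final average are post-processing, so `T` rounds cost `T ε₀² = ε̃²/2`.

The least standard ingredient is the likelihood-ratio bound for permute-and-flip. It rests on an
integral formula for the selection probabilities (`permuteAndFlip_apply`), in which a change of
scores is compensated by rescaling the integration variable. -/

namespace PMWPub

/-- `∫ f dP ≤ K (∫ f ^ β dQ) ^ (1 / β)` for all `f ≥ 0`. For conjugate exponents `α` and `β` this is
the dual form of the moment bound `∫ (dP/dQ) ^ α dQ ≤ K ^ α`. -/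
def HolderDominated {R : Type*} [MeasurableSpace R] (β : ℝ) (K : ℝ≥0∞) (P Q : Measure R) : Prop :=
  ∀ f : R → ℝ≥0∞, Measurable f → ∫⁻ x, f x ∂P ≤ K * (∫⁻ x, f x ^ β ∂Q) ^ (1 / β)

/-! ### Calculus of Hölder domination, and its conversion to Rényi and approximate privacy -/

namespace HolderDominated

variable {R S : Type*} [MeasurableSpace R] [MeasurableSpace S] {α β : ℝ} {K K' : ℝ≥0∞}

lemma map {P Q : Measure R} (h : HolderDominated β K P Q) {g : R → S} (hg : Measurable g) :
    HolderDominated β K (P.map g) (Q.map g) := fun f hf => by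
  rw [lintegral_map hf hg, lintegral_map (hf.pow_const β) hg]
  exact h _ (hf.comp hg)

/-- Adaptive composition: the fibre bound turns `f` into the `L^β(η x)` norm of `f (x, ·)`, and the
base bound is tested with that norm, whose `β`-th power undoes the root. -/
lemma compProd {P Q : Measure R} [SFinite P] [SFinite Q] {κ η : Kernel R S} [IsSFiniteKernel κ]
    [IsSFiniteKernel η] (hβ : 0 < β) (h : HolderDominated β K P Q)
    (h' : ∀ x, HolderDominated β K' (κ x) (η x)) :
    HolderDominated β (K' * K) (P ⊗ₘ κ) (Q ⊗ₘ η) := fun f hf => by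
  have hm : Measurable fun x => ∫⁻ y, f (x, y) ^ β ∂η x :=
    (hf.pow_const β).lintegral_kernel_prod_right'
  rw [Measure.lintegral_compProd hf, Measure.lintegral_compProd (hf.pow_const β)]
  calc ∫⁻ x, ∫⁻ y, f (x, y) ∂κ x ∂P
      ≤ ∫⁻ x, K' * (∫⁻ y, f (x, y) ^ β ∂η x) ^ (1 / β) ∂P :=
        lintegral_mono fun x => h' x _ (hf.comp measurable_prodMk_left)
    _ = K' * ∫⁻ x, (∫⁻ y, f (x, y) ^ β ∂η x) ^ (1 / β) ∂P :=
        lintegral_const_mul _ (hm.pow_const _)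
    _ ≤ K' * (K * (∫⁻ x, ((∫⁻ y, f (x, y) ^ β ∂η x) ^ (1 / β)) ^ β ∂Q) ^ (1 / β)) := by
        gcongr
        exact h _ (hm.pow_const _)
    _ = _ := by simp_rw [← ENNReal.rpow_mul, one_div_mul_cancel hβ.ne', ENNReal.rpow_one, mul_assoc]

lemma dirac (hβ : 0 < β) (x : R) : HolderDominated β 1 (Measure.dirac x) (Measure.dirac x) :=
  fun f hf => by
    rw [lintegral_dirac' _ hf, lintegral_dirac' _ (hf.pow_const β), ← ENNReal.rpow_mul,
      mul_one_div_cancel hβ.ne', ENNReal.rpow_one, one_mul]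

/-- Mixtures with finitely many components. -/
lemma mixture {ι : Type*} [Fintype ι] {p q : ι → ℝ≥0∞} {P Q : ι → Measure R} (hβ : 0 < β)
    (hpq : ∀ g : ι → ℝ≥0∞, ∑ i, p i * g i ≤ K * (∑ i, q i * g i ^ β) ^ (1 / β))
    (h : ∀ i, HolderDominated β K' (P i) (Q i)) :
    HolderDominated β (K' * K) (∑ i, p i • P i) (∑ i, q i • Q i) := fun f hf => by
  simp only [lintegral_finsetSum_measure, lintegral_smul_measure, smul_eq_mul]
  calc ∑ i, p i * ∫⁻ x, f x ∂P i
      ≤ ∑ i, p i * (K' * (∫⁻ x, f x ^ β ∂Q i) ^ (1 / β)) := by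
        gcongr with i
        exact h i f hf
    _ = K' * ∑ i, p i * (∫⁻ x, f x ^ β ∂Q i) ^ (1 / β) := by
        rw [Finset.mul_sum]
        exact Finset.sum_congr rfl fun i _ => mul_left_comm _ _ _
    _ ≤ K' * (K * (∑ i, q i * ((∫⁻ x, f x ^ β ∂Q i) ^ (1 / β)) ^ β) ^ (1 / β)) := by
        gcongr
        exact hpq _
    _ = _ := by simp_rw [← ENNReal.rpow_mul, one_div_mul_cancel hβ.ne', ENNReal.rpow_one, mul_assoc]

lemma measure_le {P Q : Measure R} (hβ : 0 < β) (h : HolderDominated β K P Q) {E : Set R}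
    (hE : MeasurableSet E) : P E ≤ K * Q E ^ (1 / β) := by
  have h1 := h (E.indicator 1) (measurable_one.indicator hE)
  have h2 : (fun x => (E.indicator 1 x : ℝ≥0∞) ^ β) = E.indicator 1 := by
    ext x
    by_cases hx : x ∈ E <;> simp [hx, hβ]
  rwa [h2, lintegral_indicator_one hE, lintegral_indicator_one hE] at h1

lemma absolutelyContinuous {P Q : Measure R} (hβ : 0 < β) (h : HolderDominated β K P Q) :
    P ≪ Q :=
  Measure.AbsolutelyContinuous.mk fun E hE h0 => by
    have := h.measure_le hβ hE
    rwa [h0, ENNReal.zero_rpow_of_pos (by positivity), mul_zero, nonpos_iff_eq_zero] at this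

/-- With `r = dP/dQ`, the test function `r ^ (α - 1)` gives `∫ r^α dQ ≤ K (∫ r^α dQ)^(1/β)`, because
`(α - 1) β = α`; then divide. The division needs a finite integral, so `r` is first truncated at `N`
and monotone convergence removes the truncation. -/
lemma lintegral_rnDeriv_rpow_le {P Q : Measure R} [IsFiniteMeasure P] [IsFiniteMeasure Q]
    (hαβ : α.HolderConjugate β) (h : HolderDominated β K P Q) :
    ∫⁻ x, P.rnDeriv Q x ^ α ∂Q ≤ K ^ α := by
  have hα := hαβ.pos
  have hβ := hαβ.symm.pos
  have hr : Measurable (P.rnDeriv Q) := Measure.measurable_rnDeriv P Q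
  have key : ∀ N : ℕ, ∫⁻ x, min (P.rnDeriv Q x) N ^ α ∂Q ≤ K ^ α := fun N => by
    set g : R → ℝ≥0∞ := fun x => min (P.rnDeriv Q x) N with hg
    have hgm : Measurable g := hr.min measurable_const
    have hfin : ∫⁻ x, g x ^ α ∂Q ≠ ∞ := by
      refine ne_top_of_le_ne_top ?_ (lintegral_mono (g := fun _ => (N : ℝ≥0∞) ^ α) fun x => ?_)
      · rw [lintegral_const]
        exact ENNReal.mul_ne_top (ENNReal.rpow_ne_top_of_nonneg hα.le (ENNReal.natCast_ne_top N))
          (measure_ne_top _ _)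
      · exact ENNReal.rpow_le_rpow (min_le_right _ _) hα.le
    have h1 : ∫⁻ x, g x ^ α ∂Q ≤ ∫⁻ x, g x ^ (α - 1) ∂P := by
      rw [← lintegral_rnDeriv_mul (h.absolutelyContinuous hβ) (hgm.pow_const _).aemeasurable]
      refine lintegral_mono fun x => ?_
      calc g x ^ α = g x * g x ^ (α - 1) := by
            conv_lhs => rw [show α = 1 + (α - 1) by ring]
            rw [ENNReal.rpow_add_of_nonneg _ _ zero_le_one hαβ.sub_one_pos.le, ENNReal.rpow_one]
        _ ≤ _ := by
            gcongr
            exact min_le_left _ _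
    have h2 := h1.trans (h _ (hgm.pow_const _))
    simp_rw [← ENNReal.rpow_mul, hαβ.sub_one_mul_conj] at h2
    rcases eq_or_ne (∫⁻ x, g x ^ α ∂Q) 0 with h0 | h0
    · rw [h0]
      exact zero_le
    have h3 : (∫⁻ x, g x ^ α ∂Q) ^ (1 / α) ≤ K := by
      have h4 : ∫⁻ x, g x ^ α ∂Q =
          (∫⁻ x, g x ^ α ∂Q) ^ (1 / α) * (∫⁻ x, g x ^ α ∂Q) ^ (1 / β) := by
        rw [← ENNReal.rpow_add _ _ h0 hfin, one_div, one_div, hαβ.inv_add_inv_eq_one,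
          ENNReal.rpow_one]
      rw [h4, ← h4] at h2
      have h5 := h2
      -- Only the left-hand integral is split, so that its factor with exponent `1 / β` cancels.
      nth_rw 1 [h4] at h5
      refine (ENNReal.mul_le_mul_iff_left ?_ ?_).1 h5
      · simp [ENNReal.rpow_eq_zero_iff, h0, hfin]
      · exact ENNReal.rpow_ne_top_of_nonneg (by positivity) hfin
    rw [one_div] at h3
    exact (ENNReal.rpow_inv_le_iff hα).1 h3
  have hlim : ∫⁻ x, P.rnDeriv Q x ^ α ∂Q = ⨆ N : ℕ, ∫⁻ x, min (P.rnDeriv Q x) N ^ α ∂Q := by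
    rw [← lintegral_iSup (fun N => (hr.min measurable_const).pow_const α)]
    · refine lintegral_congr fun x => ?_
      have h1 := (ENNReal.orderIsoRpow α hα).map_iSup (fun N : ℕ => min (P.rnDeriv Q x) N)
      simp only [ENNReal.orderIsoRpow_apply] at h1
      rw [← h1, ← inf_iSup_eq, ENNReal.iSup_natCast, inf_top_eq]
    · intro N M hNM x
      simp only
      gcongr
  rw [hlim]
  exact iSup_le key

lemma renyiDiv_le {P Q : Measure R} [IsFiniteMeasure P] [IsFiniteMeasure Q]
    (hαβ : α.HolderConjugate β) {ρ : ℝ}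
    (h : HolderDominated β (ENNReal.ofReal (Real.exp ((α - 1) * ρ))) P Q) :
    renyiDiv α P Q ≤ ((ρ * α : ℝ) : EReal) := by
  have h1 := hαβ.sub_one_pos
  rw [renyiDiv, if_pos (h.absolutelyContinuous hαβ.symm.pos)]
  have h2 : ENNReal.log (∫⁻ x, P.rnDeriv Q x ^ α ∂Q) ≤ (((α - 1) * ρ * α : ℝ) : EReal) := by
    refine (ENNReal.log_monotone (h.lintegral_rnDeriv_rpow_le hαβ)).trans_eq ?_
    rw [ENNReal.ofReal_rpow_of_pos (Real.exp_pos _), ← Real.exp_mul,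
      ENNReal.log_ofReal_of_pos (Real.exp_pos _), Real.log_exp]
  calc _ ≤ (((α - 1)⁻¹ : ℝ) : EReal) * (((α - 1) * ρ * α : ℝ) : EReal) :=
        mul_le_mul_of_nonneg_left h2 (by exact_mod_cast (inv_pos.2 h1).le)
    _ = _ := by
        rw [← EReal.coe_mul]
        congr 1
        field_simp

/-- Conversion of a moment bound into approximate differential privacy. -/
lemma measure_le_exp_mul_add {P Q : Measure R} [IsProbabilityMeasure Q]
    (hαβ : α.HolderConjugate β) {ρ : ℝ}
    (h : HolderDominated β (ENNReal.ofReal (Real.exp ((α - 1) * ρ))) P Q) {δ : ℝ} (hδ : 0 < δ)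
    {E : Set R} (hE : MeasurableSet E) :
    P E ≤ ENNReal.ofReal (Real.exp (ρ * α + Real.log (1 / (α * δ)) / (α - 1) +
      Real.log (1 - 1 / α))) * Q E + ENNReal.ofReal δ := by
  have hα := hαβ.pos
  have hβ := hαβ.symm.pos
  have h1 := hαβ.sub_one_pos
  refine (h.measure_le hβ hE).trans ?_
  obtain ⟨q, hq0, hq⟩ : ∃ q : ℝ, 0 ≤ q ∧ Q E = ENNReal.ofReal q :=
    ⟨(Q E).toReal, ENNReal.toReal_nonneg, (ENNReal.ofReal_toReal (measure_ne_top _ _)).symm⟩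
  rw [hq, ENNReal.ofReal_rpow_of_nonneg hq0 (by positivity), ← ENNReal.ofReal_mul (by positivity),
    ← ENNReal.ofReal_mul (by positivity), ← ENNReal.ofReal_add (by positivity) hδ.le]
  refine ENNReal.ofReal_le_ofReal ?_
  set k := ρ * α + Real.log (1 / (α * δ)) / (α - 1) + Real.log (1 - 1 / α) with hk
  have hβ' : 1 - 1 / α = β⁻¹ := by
    rw [one_div]
    linarith [hαβ.inv_add_inv_eq_one]
  have hαd : Real.exp (Real.log (α * δ)) = α * δ := Real.exp_log (by positivity)
  -- The exponent `k` is the solution of this identity: Young's inequality with weights `1/α`, `1/β`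
  -- at `αδ` and `β e^k q` then gives exactly `δ + e^k q`.
  have hkey : Real.exp ((α - 1) * ρ) = (α * δ) ^ (1 / α) * (β * Real.exp k) ^ (1 / β) := by
    rw [Real.rpow_def_of_pos (by positivity), Real.rpow_def_of_pos (by positivity),
      Real.log_mul hβ.ne' (Real.exp_pos _).ne', Real.log_exp, ← Real.exp_add, hk, hβ',
      Real.log_inv, one_div (α * δ), Real.log_inv, one_div β, ← hβ']
    congr 1
    field_simp
    ring
  have hy := Real.geom_mean_le_arith_mean2_weighted (w₁ := 1 / α) (w₂ := 1 / β) (by positivity)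
    (by positivity) (p₁ := α * δ) (p₂ := β * Real.exp k * q) (by positivity) (by positivity)
    (by rw [one_div, one_div, hαβ.inv_add_inv_eq_one])
  rw [Real.mul_rpow (x := β * Real.exp k) (by positivity) hq0, ← mul_assoc, ← hkey] at hy
  refine hy.trans_eq ?_
  field_simp
  ring

end HolderDominated

/-! ### Moment bounds for pure differential privacy and for the Gaussian mechanism -/

lemma sinh_le_mul_cosh {x : ℝ} (hx : 0 ≤ x) : Real.sinh x ≤ x * Real.cosh x := by
  have hd : ∀ y : ℝ, HasDerivAt (fun y => y * Real.cosh y - Real.sinh y)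
      (y * Real.sinh y) y := fun y => by
    have := ((hasDerivAt_id y).mul (Real.hasDerivAt_cosh y)).sub (Real.hasDerivAt_sinh y)
    convert! this using 1
    simp
  have hm : MonotoneOn (fun y => y * Real.cosh y - Real.sinh y) (Set.Ici 0) := by
    refine monotoneOn_of_deriv_nonneg (convex_Ici 0)
      (fun y _ => (hd y).continuousAt.continuousWithinAt)
      (fun y _ => (hd y).differentiableAt.differentiableWithinAt) fun y hy => ?_
    rw [interior_Ici, Set.mem_Ioi] at hy
    rw [(hd y).deriv]
    exact mul_nonneg hy.le (Real.sinh_nonneg_iff.2 hy.le)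
  have := hm Set.self_mem_Ici (Set.mem_Ici.2 hx) hx
  simp only [zero_mul, Real.sinh_zero, sub_zero] at this
  linarith

/-- The function `cosh y · exp (-y²/2)` decreases on `[0, ∞)`: its derivative has the sign of `sinh
y - y cosh y`. -/
lemma cosh_le_cosh_mul_exp {x y : ℝ} (hx : 0 ≤ x) (hxy : x ≤ y) :
    Real.cosh y ≤ Real.cosh x * Real.exp ((y ^ 2 - x ^ 2) / 2) := by
  have hd : ∀ y : ℝ, HasDerivAt (fun y => Real.cosh y * Real.exp (-(y ^ 2 / 2)))
      ((Real.sinh y - y * Real.cosh y) * Real.exp (-(y ^ 2 / 2))) y := fun y => by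
    have h1 : HasDerivAt (fun y : ℝ => -(y ^ 2 / 2)) (-y) y := by
      have := ((hasDerivAt_pow 2 y).div_const 2).neg
      convert! this using 1
      simp
    have := (Real.hasDerivAt_cosh y).mul h1.exp
    convert! this using 1
    ring
  have hm : AntitoneOn (fun y => Real.cosh y * Real.exp (-(y ^ 2 / 2))) (Set.Ici 0) := by
    refine antitoneOn_of_deriv_nonpos (convex_Ici 0)
      (fun y _ => (hd y).continuousAt.continuousWithinAt)
      (fun y _ => (hd y).differentiableAt.differentiableWithinAt) fun y hy => ?_
    rw [interior_Ici, Set.mem_Ioi] at hy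
    rw [(hd y).deriv]
    exact mul_nonpos_of_nonpos_of_nonneg (by linarith [sinh_le_mul_cosh hy.le])
      (Real.exp_pos _).le
  have h := hm (Set.mem_Ici.2 hx) (Set.mem_Ici.2 (hx.trans hxy)) hxy
  simp only at h
  calc Real.cosh y = Real.cosh y * Real.exp (-(y ^ 2 / 2)) * Real.exp (y ^ 2 / 2) := by
        rw [mul_assoc, ← Real.exp_add, neg_add_cancel, Real.exp_zero, mul_one]
    _ ≤ Real.cosh x * Real.exp (-(x ^ 2 / 2)) * Real.exp (y ^ 2 / 2) := by gcongr
    _ = _ := by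
        rw [mul_assoc, ← Real.exp_add]
        ring_nf

/-- Convexity of `x ^ α`: its graph lies below the chord over `[e^(-ε), e^ε]`. With denominators
cleared, the degenerate interval is included. -/
lemma rpow_le_chord {α ε x : ℝ} (hα : 1 ≤ α) (hl : Real.exp (-ε) ≤ x) (hu : x ≤ Real.exp ε) :
    (Real.exp ε - Real.exp (-ε)) * x ^ α ≤
      (Real.exp ε - x) * Real.exp (-(α * ε)) + (x - Real.exp (-ε)) * Real.exp (α * ε) := by
  rcases eq_or_lt_of_le (hl.trans hu) with h | h
  · have h1 : x = Real.exp ε := le_antisymm hu (h ▸ hl)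
    have h2 : x = Real.exp (-ε) := h1.trans h.symm
    rw [← h1, ← h2]
    simp
  have hd : 0 < Real.exp ε - Real.exp (-ε) := sub_pos.2 h
  have hc := (convexOn_rpow hα).2 (Set.mem_Ici.2 (Real.exp_pos (-ε)).le)
    (Set.mem_Ici.2 (Real.exp_pos ε).le)
    (div_nonneg (sub_nonneg.2 hu) hd.le) (div_nonneg (sub_nonneg.2 hl) hd.le)
    (by rw [← add_div, sub_add_sub_cancel, div_self hd.ne'])
  simp only [smul_eq_mul, ← Real.exp_mul] at hc
  have hx : (Real.exp ε - x) / (Real.exp ε - Real.exp (-ε)) * Real.exp (-ε) +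
      (x - Real.exp (-ε)) / (Real.exp ε - Real.exp (-ε)) * Real.exp ε = x := by
    field_simp
    ring
  rw [hx, div_mul_eq_mul_div, div_mul_eq_mul_div, ← add_div, le_div_iff₀ hd] at hc
  calc _ = x ^ α * (Real.exp ε - Real.exp (-ε)) := mul_comm _ _
    _ ≤ _ := hc
    _ = _ := by
      rw [mul_comm ε α, neg_mul, mul_comm ε α]

/-- A pair of distributions whose likelihood ratio lies in `[e⁻ᵉ, eᵉ]` has Rényi divergence at
most `½ ε² α`. -/
lemma sum_mul_ratio_rpow_le {ι : Type*} [Fintype ι] {p q : ι → ℝ} (hq : ∀ i, 0 < q i)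
    (hp1 : ∑ i, p i = 1) (hq1 : ∑ i, q i = 1) {ε α : ℝ} (hε : 0 < ε) (hα : 1 < α)
    (hpq : ∀ i, p i ≤ Real.exp ε * q i) (hqp : ∀ i, q i ≤ Real.exp ε * p i) :
    ∑ i, q i * (p i / q i) ^ α ≤ Real.exp ((α - 1) * (ε ^ 2 / 2) * α) := by
  have h1 : ∀ i, (Real.exp ε - Real.exp (-ε)) * (q i * (p i / q i) ^ α) ≤
      (Real.exp ε * q i - p i) * Real.exp (-(α * ε)) +
        (p i - Real.exp (-ε) * q i) * Real.exp (α * ε) := fun i => by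
    have hx := rpow_le_chord (x := p i / q i) (ε := ε) hα.le
      (by
        rw [le_div_iff₀ (hq i), Real.exp_neg, inv_mul_le_iff₀ (Real.exp_pos _)]
        exact hqp i)
      (by
        rw [div_le_iff₀ (hq i)]
        exact hpq i)
    have h2 := mul_le_mul_of_nonneg_left hx (hq i).le
    calc _ = q i * ((Real.exp ε - Real.exp (-ε)) * (p i / q i) ^ α) := by ring
      _ ≤ _ := h2
      _ = _ := by
        have := (hq i).ne'
        field_simp
  -- The chord is affine in the ratio, so after summation only the total masses of `p` and `q`
  -- remain.
  have h2 := Finset.sum_le_sum fun i (_ : i ∈ Finset.univ) => h1 i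
  rw [← Finset.mul_sum, Finset.sum_add_distrib, ← Finset.sum_mul, ← Finset.sum_mul,
    Finset.sum_sub_distrib, Finset.sum_sub_distrib, ← Finset.mul_sum, ← Finset.mul_sum, hp1, hq1,
    mul_one, mul_one] at h2
  have hz : 0 < ε / 2 := by positivity
  -- In half-angles the summed bound is `cosh ((2α - 1) ε/2) / cosh (ε/2)`.
  have hc := cosh_le_cosh_mul_exp hz.le (y := (2 * α - 1) * (ε / 2)) (by nlinarith)
  have hexp : ((2 * α - 1) * (ε / 2)) ^ 2 - (ε / 2) ^ 2 = 2 * ((α - 1) * (ε ^ 2 / 2) * α) := by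
    ring
  rw [hexp, mul_div_cancel_left₀ _ two_ne_zero] at hc
  have hs : 0 < Real.sinh (ε / 2) := Real.sinh_pos_iff.2 hz
  have hl : Real.exp ε - Real.exp (-ε) = 4 * Real.sinh (ε / 2) * Real.cosh (ε / 2) := by
    have : Real.sinh ε = 2 * Real.sinh (ε / 2) * Real.cosh (ε / 2) := by
      rw [← Real.sinh_two_mul]
      ring_nf
    rw [Real.sinh_eq] at this
    linarith
  have hr : (Real.exp ε - 1) * Real.exp (-(α * ε)) + (1 - Real.exp (-ε)) * Real.exp (α * ε) =
      4 * Real.sinh (ε / 2) * Real.cosh ((2 * α - 1) * (ε / 2)) := by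
    rw [Real.sinh_eq, Real.cosh_eq]
    have e1 : Real.exp ε * Real.exp (-(α * ε)) =
        Real.exp (ε / 2) * Real.exp (-((2 * α - 1) * (ε / 2))) := by
      rw [← Real.exp_add, ← Real.exp_add]
      ring_nf
    have e2 : Real.exp (-(α * ε)) =
        Real.exp (-(ε / 2)) * Real.exp (-((2 * α - 1) * (ε / 2))) := by
      rw [← Real.exp_add]
      ring_nf
    have e3 : Real.exp (α * ε) = Real.exp (ε / 2) * Real.exp ((2 * α - 1) * (ε / 2)) := by
      rw [← Real.exp_add]
      ring_nf
    have e4 : Real.exp (-ε) * Real.exp (α * ε) =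
        Real.exp (-(ε / 2)) * Real.exp ((2 * α - 1) * (ε / 2)) := by
      rw [← Real.exp_add, ← Real.exp_add]
      ring_nf
    linear_combination e1 - e2 + e3 - e4
  rw [hl, hr] at h2
  have hcz := Real.cosh_pos (ε / 2)
  refine le_of_mul_le_mul_left ?_ (show 0 < 4 * Real.sinh (ε / 2) * Real.cosh (ε / 2) by positivity)
  calc _ ≤ _ := h2
    _ ≤ 4 * Real.sinh (ε / 2) *
        (Real.cosh (ε / 2) * Real.exp ((α - 1) * (ε ^ 2 / 2) * α)) := by gcongr
    _ = _ := by ring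

/-- Hölder's inequality dualizes the moment bound into the form that `mixture` requires of its
weights. -/
lemma sum_mul_le_of_ratio {ι : Type*} [Fintype ι] {p q : PMF ι} (hq0 : ∀ i, q i ≠ 0)
    {ε α β : ℝ} (hε : 0 < ε) (hαβ : α.HolderConjugate β)
    (hpq : ∀ i, p i ≤ ENNReal.ofReal (Real.exp ε) * q i)
    (hqp : ∀ i, q i ≤ ENNReal.ofReal (Real.exp ε) * p i) (g : ι → ℝ≥0∞) :
    ∑ i, p i * g i ≤
      ENNReal.ofReal (Real.exp ((α - 1) * (ε ^ 2 / 2))) * (∑ i, q i * g i ^ β) ^ (1 / β) := by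
  have hα := hαβ.pos
  have hβ := hαβ.symm.pos
  have hsum : ∀ r : PMF ι, ∑ i, (r i).toReal = 1 := fun r => by
    have h := r.tsum_coe
    rw [tsum_fintype] at h
    rw [← ENNReal.toReal_sum fun i _ => r.apply_ne_top i, h, ENNReal.toReal_one]
  have hreal : ∀ r s : PMF ι, (∀ i, r i ≤ ENNReal.ofReal (Real.exp ε) * s i) →
      ∀ i, (r i).toReal ≤ Real.exp ε * (s i).toReal := fun r s h i => by
    have := ENNReal.toReal_mono (ENNReal.mul_ne_top ENNReal.ofReal_ne_top (s.apply_ne_top i)) (h i)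
    rwa [ENNReal.toReal_mul, ENNReal.toReal_ofReal (Real.exp_pos _).le] at this
  have hqr : ∀ i, 0 < (q i).toReal := fun i => ENNReal.toReal_pos (hq0 i) (q.apply_ne_top i)
  have hmom := sum_mul_ratio_rpow_le hqr (hsum p) (hsum q) hε hαβ.lt (hreal p q hpq)
    (hreal q p hqp)
  have hmom' : ∑ i, q i * (p i / q i) ^ α ≤
      ENNReal.ofReal (Real.exp ((α - 1) * (ε ^ 2 / 2) * α)) := by
    refine le_trans (le_of_eq ?_) (ENNReal.ofReal_le_ofReal hmom)
    rw [ENNReal.ofReal_sum_of_nonneg fun i _ => by positivity]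
    refine Finset.sum_congr rfl fun i _ => ?_
    rw [ENNReal.ofReal_mul ENNReal.toReal_nonneg, ENNReal.ofReal_toReal (q.apply_ne_top i),
      ← ENNReal.ofReal_rpow_of_nonneg (by positivity) hα.le, ENNReal.ofReal_div_of_pos (hqr i),
      ENNReal.ofReal_toReal (q.apply_ne_top i), ENNReal.ofReal_toReal (p.apply_ne_top i)]
  have hsplit : ∀ i, p i * g i = (q i ^ (1 / α) * (p i / q i)) * (q i ^ (1 / β) * g i) :=
    fun i => by
      calc p i * g i = (q i ^ (1 / α) * q i ^ (1 / β)) * (p i / q i) * g i := by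
            rw [← ENNReal.rpow_add _ _ (hq0 i) (q.apply_ne_top i), one_div, one_div,
              hαβ.inv_add_inv_eq_one, ENNReal.rpow_one,
              ENNReal.mul_div_cancel (hq0 i) (q.apply_ne_top i)]
        _ = _ := by ring
  simp_rw [hsplit]
  refine (ENNReal.inner_le_Lp_mul_Lq _ _ _ hαβ).trans ?_
  simp_rw [ENNReal.mul_rpow_of_nonneg _ _ hα.le, ENNReal.mul_rpow_of_nonneg _ _ hβ.le,
    ← ENNReal.rpow_mul, one_div_mul_cancel hα.ne', one_div_mul_cancel hβ.ne', ENNReal.rpow_one]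
  gcongr
  refine (ENNReal.rpow_le_rpow hmom' (by positivity)).trans_eq ?_
  rw [ENNReal.ofReal_rpow_of_pos (Real.exp_pos _), ← Real.exp_mul, mul_assoc,
    mul_one_div_cancel hα.ne', mul_one]

/-! ### Hölder domination between Gaussians -/

namespace HolderDominated

/-- Hölder's inequality gives the converse of `lintegral_rnDeriv_rpow_le`, for an explicit density.
-/
lemma of_lintegral_rpow_le {R : Type*} [MeasurableSpace R] {α β : ℝ} (hαβ : α.HolderConjugate β)
    {Q : Measure R} {h : R → ℝ≥0∞} (hm : Measurable h) {K : ℝ≥0∞}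
    (hK : ∫⁻ x, h x ^ α ∂Q ≤ K ^ α) : HolderDominated β K (Q.withDensity h) Q := fun f hf => by
  rw [lintegral_withDensity_eq_lintegral_mul _ hm hf]
  refine (ENNReal.lintegral_mul_le_Lp_mul_Lq Q hαβ hm.aemeasurable hf.aemeasurable).trans ?_
  gcongr
  rw [one_div]
  exact (ENNReal.rpow_inv_le_iff hαβ.pos).2 hK

lemma mono {R : Type*} [MeasurableSpace R] {β : ℝ} {K K' : ℝ≥0∞} {P Q : Measure R}
    (h : HolderDominated β K P Q) (hK : K ≤ K') : HolderDominated β K' P Q := fun f hf =>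
  (h f hf).trans (by gcongr)

lemma gaussianReal {α β : ℝ} (hαβ : α.HolderConjugate β) (a b : ℝ) {v : ℝ≥0} (hv : v ≠ 0) :
    HolderDominated β (ENNReal.ofReal (Real.exp ((α - 1) * ((a - b) ^ 2 / (2 * v)))))
      (ProbabilityTheory.gaussianReal a v) (ProbabilityTheory.gaussianReal b v) := by
  set h : ℝ → ℝ := fun x => Real.exp (((x - b) ^ 2 - (x - a) ^ 2) / (2 * v))
  have hv' : (v : ℝ) ≠ 0 := by exact_mod_cast hv
  have hm : Measurable fun x => ENNReal.ofReal (h x) := by fun_prop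
  have hd : ProbabilityTheory.gaussianReal a v =
      (ProbabilityTheory.gaussianReal b v).withDensity fun x => ENNReal.ofReal (h x) := by
    rw [gaussianReal_of_var_ne_zero _ hv, gaussianReal_of_var_ne_zero _ hv,
      ← withDensity_mul _ (measurable_gaussianPDF _ _) hm]
    congr 1
    ext x
    rw [Pi.mul_apply, gaussianPDF, gaussianPDF, ← ENNReal.ofReal_mul (gaussianPDFReal_nonneg _ _ _),
      gaussianPDFReal, gaussianPDFReal, mul_assoc _⁻¹, ← Real.exp_add]
    congr 3
    field_simp
    ring
  rw [hd]
  refine of_lintegral_rpow_le hαβ hm (le_of_eq ?_)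
  rw [gaussianReal_of_var_ne_zero _ hv, lintegral_withDensity_eq_lintegral_mul _
    (measurable_gaussianPDF _ _) (hm.pow_const _)]
  -- Completing the square: the tilted density is a constant times the Gaussian density centred at
  -- `αa + (1 - α)b`, so the moment is computed exactly.
  have hpt : ∀ x, (gaussianPDF b v * fun x => ENNReal.ofReal (h x) ^ α) x =
      ENNReal.ofReal (Real.exp ((α - 1) * ((a - b) ^ 2 / (2 * v)))) ^ α *
        gaussianPDF (α * a + (1 - α) * b) v x := fun x => by
    rw [Pi.mul_apply, ENNReal.ofReal_rpow_of_pos (Real.exp_pos _),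
      ENNReal.ofReal_rpow_of_pos (Real.exp_pos _), gaussianPDF, gaussianPDF,
      ← ENNReal.ofReal_mul (gaussianPDFReal_nonneg _ _ _), ← ENNReal.ofReal_mul (by positivity),
      gaussianPDFReal, gaussianPDFReal, ← Real.exp_mul, ← Real.exp_mul, mul_left_comm, mul_assoc,
      ← Real.exp_add, ← Real.exp_add]
    congr 3
    field_simp
    ring
  simp_rw [hpt]
  rw [lintegral_const_mul _ (measurable_gaussianPDF _ _), lintegral_gaussianPDF_eq_one _ hv,
    mul_one]

end HolderDominated

/-! ### Pure differential privacy of the selection mechanisms -/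

section Selection

variable {R : Type*} [Fintype R]

/-- The numerator and the normalizing sum each contribute a factor `exp (η d)`. -/
lemma exp_mul_div_sum_le [Nonempty R] {u u' : R → ℝ} {η d : ℝ} (hη : 0 ≤ η)
    (hu : ∀ r, |u r - u' r| ≤ d) (r : R) :
    Real.exp (η * u r) / ∑ s, Real.exp (η * u s) ≤
      Real.exp (2 * (η * d)) * (Real.exp (η * u' r) / ∑ s, Real.exp (η * u' s)) := by
  have hpos : ∀ v : R → ℝ, 0 < ∑ s, Real.exp (η * v s) := fun v =>
    Finset.sum_pos (fun s _ => Real.exp_pos _) Finset.univ_nonempty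
  have h1 : Real.exp (η * u r) ≤ Real.exp (η * d) * Real.exp (η * u' r) := by
    rw [← Real.exp_add, Real.exp_le_exp]
    nlinarith [(abs_le.1 (hu r)).2]
  have h2 : ∑ s, Real.exp (η * u' s) ≤ Real.exp (η * d) * ∑ s, Real.exp (η * u s) := by
    rw [Finset.mul_sum]
    refine Finset.sum_le_sum fun s _ => ?_
    rw [← Real.exp_add, Real.exp_le_exp]
    nlinarith [(abs_le.1 (hu s)).1]
  rw [two_mul, Real.exp_add, ← mul_div_assoc, div_le_div_iff₀ (hpos u) (hpos u')]
  calc _ ≤ (Real.exp (η * d) * Real.exp (η * u' r)) * (Real.exp (η * d) *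
      ∑ s, Real.exp (η * u s)) := by
        have := (hpos u').le
        gcongr
    _ = _ := by ring

open Classical in
/-- In a uniformly random order, `r` comes last in `insert r K` with probability
`1 / (#K + 1)`. -/
lemma card_add_one_mul_card_filter_last (r : R) {K : Finset R} (hr : r ∉ K) :
    (K.card + 1) * (Finset.univ.filter fun σ : R ≃ Fin (Fintype.card R) =>
      ∀ s ∈ K, σ s < σ r).card = Fintype.card (R ≃ Fin (Fintype.card R)) := by
  set L := insert r K with hL
  -- `N r'` collects the orders in which `r'` comes last in `L`. Transpositions make these sets
  -- equinumerous, and each order lies in exactly one of them.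
  let N : R → Finset (R ≃ Fin (Fintype.card R)) := fun r' =>
    Finset.univ.filter fun σ => ∀ s ∈ L, σ s ≤ σ r'
  have hN : (Finset.univ.filter fun σ : R ≃ Fin (Fintype.card R) => ∀ s ∈ K, σ s < σ r) = N r := by
    ext σ
    simp only [N, hL, Finset.mem_filter, Finset.mem_univ, true_and, Finset.forall_mem_insert,
      le_refl]
    refine forall₂_congr fun s hs => ⟨le_of_lt, fun h => lt_of_le_of_ne h fun h' => ?_⟩
    exact hr (σ.injective h' ▸ hs)
  have hswap : ∀ r' ∈ L, (N r').card = (N r).card := fun r' hr' => by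
    have hmem : ∀ s ∈ L, Equiv.swap r r' s ∈ L := fun s hs => by
      by_cases h1 : s = r
      · rwa [h1, Equiv.swap_apply_left]
      by_cases h2 : s = r'
      · rw [h2, Equiv.swap_apply_right]
        exact Finset.mem_insert_self _ _
      rwa [Equiv.swap_apply_of_ne_of_ne h1 h2]
    refine Finset.card_equiv (Equiv.equivCongr (Equiv.swap r r') (Equiv.refl _)) fun σ => ?_
    simp only [N, Finset.mem_filter, Finset.mem_univ, true_and, Equiv.equivCongr_apply_apply,
      Equiv.refl_apply, Equiv.symm_swap, Equiv.swap_apply_left]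
    refine ⟨fun h s hs => h _ (hmem s hs), fun h s hs => ?_⟩
    simpa using h _ (hmem s hs)
  have hone : ∀ σ : R ≃ Fin (Fintype.card R), (L.filter fun r' => σ ∈ N r').card = 1 := fun σ => by
    obtain ⟨r', hr', hmax⟩ := Finset.exists_max_image L σ ⟨r, Finset.mem_insert_self _ _⟩
    refine Finset.card_eq_one.2 ⟨r', ?_⟩
    ext s
    simp only [N, Finset.mem_filter, Finset.mem_univ, true_and, Finset.mem_singleton]
    refine ⟨fun h => σ.injective (le_antisymm (hmax s h.1) (h.2 r' hr')), ?_⟩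
    rintro rfl
    exact ⟨hr', hmax⟩
  calc _ = ∑ r' ∈ L, (N r').card := by
        rw [hN, Finset.sum_congr rfl hswap, Finset.sum_const, hL, Finset.card_insert_of_notMem hr,
          smul_eq_mul]
    _ = ∑ σ : R ≃ Fin (Fintype.card R), (L.filter fun r' => σ ∈ N r').card := by
        simp_rw [Finset.card_eq_sum_ones, Finset.sum_filter]
        rw [Finset.sum_comm]
        refine Finset.sum_congr rfl fun r' _ => ?_
        rw [← Finset.sum_filter, Finset.filter_univ_mem]
    _ = _ := by simp [hone]

open Classical in
-- A random order arises from independent uniform arrival times. If `r` arrives at time `t`, every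
-- other `s` precedes it independently with probability `t` and contributes `1 - t * a s` on
-- average. The proof matches the coefficients `1 / (#K + 1)` of the expansions over subsets `K`.
lemma sum_prod_one_sub_lt_eq_integral (a : R → ℝ) (r : R) :
    ∑ σ : R ≃ Fin (Fintype.card R), ∏ s with σ s < σ r, (1 - a s) =
      Fintype.card (R ≃ Fin (Fintype.card R)) *
        ∫ t in (0 : ℝ)..1, ∏ s ∈ Finset.univ.erase r, (1 - t * a s) := by
  have hint : ∫ t in (0 : ℝ)..1, ∏ s ∈ Finset.univ.erase r, (1 - t * a s) =
      ∑ K ∈ (Finset.univ.erase r).powerset, (∏ s ∈ K, -a s) / (K.card + 1) := by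
    have hexp : ∀ t : ℝ, ∏ s ∈ Finset.univ.erase r, (1 - t * a s) =
        ∑ K ∈ (Finset.univ.erase r).powerset, (∏ s ∈ K, -a s) * t ^ K.card := fun t => by
      simp_rw [sub_eq_add_neg, ← mul_neg]
      rw [Finset.prod_one_add]
      refine Finset.sum_congr rfl fun K _ => ?_
      rw [Finset.prod_mul_distrib, Finset.prod_const, mul_comm]
    simp_rw [hexp]
    rw [intervalIntegral.integral_finsetSum fun K _ =>
      (by fun_prop : Continuous fun t : ℝ => (∏ s ∈ K, -a s) * t ^ K.card).intervalIntegrable _ _]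
    refine Finset.sum_congr rfl fun K _ => ?_
    rw [intervalIntegral.integral_const_mul, integral_pow]
    simp [div_eq_mul_inv]
  rw [hint, Finset.mul_sum]
  have hexp : ∀ σ : R ≃ Fin (Fintype.card R), ∏ s with σ s < σ r, (1 - a s) =
      ∑ K ∈ (Finset.univ.erase r).powerset, if ∀ s ∈ K, σ s < σ r then ∏ s ∈ K, -a s else 0 :=
    fun σ => by
      simp_rw [sub_eq_add_neg]
      rw [Finset.prod_one_add, ← Finset.sum_filter]
      refine Finset.sum_congr ?_ fun _ _ => rfl
      ext K
      simp only [Finset.mem_powerset, Finset.mem_filter, Finset.subset_iff, Finset.mem_univ,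
        true_and, Finset.mem_erase, and_true]
      exact ⟨fun h => ⟨fun s hs hsr => (h hs).ne (by rw [hsr]), fun s hs => h hs⟩,
        fun h s hs => h.2 hs⟩
  simp_rw [hexp]
  rw [Finset.sum_comm]
  refine Finset.sum_congr rfl fun K hK => ?_
  have hr : r ∉ K := fun h => by simpa using Finset.mem_powerset.1 hK h
  rw [← Finset.sum_filter, Finset.sum_const, ← card_add_one_mul_card_filter_last r hr]
  push_cast
  rw [nsmul_eq_mul]
  field_simp

open Classical in
/-- The rescaled integral form of the probability that permute-and-flip returns `r`. -/
lemma permuteAndFlip_apply [Nonempty R] {η : ℝ} (hη : 0 ≤ η) (u : R → ℝ) (r : R) :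
    permuteAndFlip hη u r = ENNReal.ofReal (Real.exp (η * u r) *
      ∫ t in (0 : ℝ)..Real.exp (-(η * maxScore u)),
        ∏ s ∈ Finset.univ.erase r, (1 - t * Real.exp (η * u s))) := by
  have hacc : ∀ s, acceptProb η u s = Real.exp (η * u s) * Real.exp (-(η * maxScore u)) :=
    fun s => by
      rw [acceptProb, ← Real.exp_add]
      ring_nf
  have : Nonempty (R ≃ Fin (Fintype.card R)) := ⟨Fintype.equivFin R⟩
  have hN : (0 : ℝ) < Fintype.card (R ≃ Fin (Fintype.card R)) := by
    exact_mod_cast Fintype.card_pos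
  have h0 : ∀ σ : R ≃ Fin (Fintype.card R),
      0 ≤ acceptProb η u r * ∏ s with σ s < σ r, (1 - acceptProb η u s) := fun σ =>
    mul_nonneg (Real.exp_pos _).le
      (Finset.prod_nonneg fun s _ => sub_nonneg.2 (acceptProb_le_one hη u s))
  have hsum : permuteAndFlip hη u r =
      ENNReal.ofReal ((Fintype.card (R ≃ Fin (Fintype.card R)) : ℝ)⁻¹ *
        ∑ σ : R ≃ Fin (Fintype.card R),
          (acceptProb η u r * ∏ s with σ s < σ r, (1 - acceptProb η u s))) := by
    rw [ENNReal.ofReal_mul (by positivity), ENNReal.ofReal_sum_of_nonneg fun σ _ => h0 σ,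
      ENNReal.ofReal_inv_of_pos hN, ENNReal.ofReal_natCast, Finset.mul_sum]
    simp only [permuteAndFlip, PMF.bind_apply, tsum_fintype, firstAccepted, PMF.ofFintype_apply,
      PMF.uniformOfFintype_apply]
  rw [hsum, ← Finset.mul_sum, sum_prod_one_sub_lt_eq_integral, mul_left_comm,
    inv_mul_cancel_left₀ hN.ne', hacc r, mul_assoc]
  -- Rescaling time moves the maximal score out of all acceptance probabilities and into the upper
  -- limit.
  have hsub := intervalIntegral.mul_integral_comp_mul_right (a := 0) (b := 1)
    (f := fun t => ∏ s ∈ Finset.univ.erase r, (1 - t * Real.exp (η * u s)))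
    (Real.exp (-(η * maxScore u)))
  rw [zero_mul, one_mul] at hsub
  rw [← hsub]
  simp_rw [hacc, mul_assoc, mul_comm (Real.exp (-(η * maxScore u)))]

/-- Makes every factor of the integrand in `permuteAndFlip_apply` nonnegative on the range of
integration. -/
lemma exp_mul_maxScore_le [Nonempty R] {η : ℝ} (hη : 0 ≤ η) (u : R → ℝ) {t : ℝ}
    (ht : t ≤ Real.exp (-(η * maxScore u))) (s : R) : t * Real.exp (η * u s) ≤ 1 := by
  calc t * Real.exp (η * u s) ≤ Real.exp (-(η * maxScore u)) * Real.exp (η * u s) := by gcongr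
    _ ≤ 1 := by
      rw [← Real.exp_add, Real.exp_le_one_iff]
      have : u s ≤ maxScore u := Finset.le_sup' u (Finset.mem_univ s)
      nlinarith

/-- With `c = exp (η d)`, the prefactor costs one `c` and the substitution `t ↦ c t` another. After
it the integrand is dominated pointwise, since `exp (η u') ≤ c exp (η u)`, and the new range fits
into the old one, since the maxima differ by at most `d`. -/
lemma permuteAndFlip_le [Nonempty R] {u u' : R → ℝ} {η d : ℝ} (hη : 0 ≤ η)
    (hu : ∀ r, |u r - u' r| ≤ d) (r : R) :
    permuteAndFlip hη u r ≤ ENNReal.ofReal (Real.exp (2 * (η * d))) * permuteAndFlip hη u' r := by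
  classical
  rw [permuteAndFlip_apply, permuteAndFlip_apply, ← ENNReal.ofReal_mul (Real.exp_pos _).le]
  refine ENNReal.ofReal_le_ofReal ?_
  set c := Real.exp (η * d) with hc
  have hc0 : 0 < c := Real.exp_pos _
  set y := Real.exp (-(η * maxScore u))
  set y' := Real.exp (-(η * maxScore u'))
  have hmax : maxScore u' ≤ maxScore u + d := Finset.sup'_le _ _ fun s _ => by
    have : u s ≤ maxScore u := Finset.le_sup' u (Finset.mem_univ s)
    linarith [(abs_le.1 (hu s)).1]
  have hy0 : 0 < y := Real.exp_pos _
  have hyy : y ≤ c * y' := by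
    rw [hc, ← Real.exp_add, Real.exp_le_exp]
    nlinarith
  have hyc : y / c ≤ y' := by
    rwa [div_le_iff₀' hc0]
  have hr : Real.exp (η * u r) ≤ c * Real.exp (η * u' r) := by
    rw [hc, ← Real.exp_add, Real.exp_le_exp]
    nlinarith [(abs_le.1 (hu r)).2]
  have hs : ∀ s, Real.exp (η * u' s) ≤ c * Real.exp (η * u s) := fun s => by
    rw [hc, ← Real.exp_add, Real.exp_le_exp]
    nlinarith [(abs_le.1 (hu s)).1]
  have hsub := intervalIntegral.mul_integral_comp_mul_right (a := 0) (b := y / c)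
    (f := fun t => ∏ s ∈ Finset.univ.erase r, (1 - t * Real.exp (η * u s))) c
  rw [zero_mul, div_mul_cancel₀ _ hc0.ne'] at hsub
  have h1 : ∫ t in (0 : ℝ)..y / c, ∏ s ∈ Finset.univ.erase r, (1 - t * c * Real.exp (η * u s)) ≤
      ∫ t in (0 : ℝ)..y / c, ∏ s ∈ Finset.univ.erase r, (1 - t * Real.exp (η * u' s)) := by
    refine intervalIntegral.integral_mono_on (by positivity)
      (Continuous.intervalIntegrable (by fun_prop) _ _)
      (Continuous.intervalIntegrable (by fun_prop) _ _) fun t ht => ?_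
    refine Finset.prod_le_prod (fun s _ => ?_) fun s _ => ?_
    · exact sub_nonneg.2 (exp_mul_maxScore_le hη u ((le_div_iff₀ hc0).1 ht.2) s)
    · have := mul_le_mul_of_nonneg_left (hs s) ht.1
      linarith
  have h2 : ∫ t in (0 : ℝ)..y / c, ∏ s ∈ Finset.univ.erase r, (1 - t * Real.exp (η * u' s)) ≤
      ∫ t in (0 : ℝ)..y', ∏ s ∈ Finset.univ.erase r, (1 - t * Real.exp (η * u' s)) := by
    refine intervalIntegral.integral_mono_interval le_rfl (by positivity) hyc ?_
      (Continuous.intervalIntegrable (by fun_prop) _ _)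
    refine (ae_restrict_iff' measurableSet_Ioc).2 (.of_forall fun t ht => ?_)
    exact Finset.prod_nonneg fun s _ => sub_nonneg.2 (exp_mul_maxScore_le hη u' ht.2 s)
  have h0 : 0 ≤ ∫ t in (0 : ℝ)..y / c,
      ∏ s ∈ Finset.univ.erase r, (1 - t * c * Real.exp (η * u s)) :=
    intervalIntegral.integral_nonneg (by positivity) fun t ht =>
      Finset.prod_nonneg fun s _ =>
        sub_nonneg.2 (exp_mul_maxScore_le hη u ((le_div_iff₀ hc0).1 ht.2) s)
  rw [← hsub, two_mul, Real.exp_add, ← hc]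
  calc _ ≤ (c * Real.exp (η * u' r)) * (c * ∫ t in (0 : ℝ)..y',
        ∏ s ∈ Finset.univ.erase r, (1 - t * Real.exp (η * u' s))) := by
        refine mul_le_mul hr ?_ (by positivity) (by positivity)
        gcongr
        exact h1.trans h2
    _ = _ := by ring

/-- Both selection mechanisms are purely differentially private. -/
lemma select_le [Nonempty R] (rule : SelectionRule) {u u' : R → ℝ} {η d : ℝ} (hη : 0 ≤ η)
    (hu : ∀ r, |u r - u' r| ≤ d) (r : R) :
    select rule hη u r ≤ ENNReal.ofReal (Real.exp (2 * (η * d))) * select rule hη u' r := by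
  cases rule with
  | exponential =>
    simp only [select, exponentialMechanism, PMF.ofFintype_apply]
    rw [← ENNReal.ofReal_mul (Real.exp_pos _).le]
    exact ENNReal.ofReal_le_ofReal (exp_mul_div_sum_le hη hu r)
  | permuteAndFlip => exact permuteAndFlip_le hη hu r

lemma select_ne_zero [Nonempty R] (rule : SelectionRule) (u : R → ℝ) {η : ℝ} (hη : 0 ≤ η) (r : R) :
    select rule hη u r ≠ 0 := by
  cases rule with
  | exponential =>
    simp only [select, exponentialMechanism, PMF.ofFintype_apply, ne_eq, ENNReal.ofReal_eq_zero,
      not_le]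
    exact div_pos (Real.exp_pos _)
      (Finset.sum_pos (fun s _ => Real.exp_pos _) Finset.univ_nonempty)
  | permuteAndFlip =>
    classical
    simp only [select, permuteAndFlip_apply, ne_eq, ENNReal.ofReal_eq_zero, not_le]
    refine mul_pos (Real.exp_pos _) (intervalIntegral.intervalIntegral_pos_of_pos_on
      (Continuous.intervalIntegrable (by fun_prop) _ _) (fun t ht => ?_) (Real.exp_pos _))
    refine Finset.prod_pos fun s _ => sub_pos.2 ?_
    exact (mul_lt_mul_of_pos_right ht.2 (Real.exp_pos _)).trans_le
      (exp_mul_maxScore_le hη u le_rfl s)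

end Selection

/-! ### Privacy cost of one round and composition over all rounds -/

section Algorithm

variable {X : Type*}

lemma abs_queryData_sub_le {n : ℕ} {D D' : Fin n → X} (h : Neighboring D D')
    (q : X → unitInterval) : |queryData q D - queryData q D'| ≤ 1 / n := by
  obtain ⟨i, hi⟩ := h
  have hs : ∑ j, (q (D j) : ℝ) - ∑ j, (q (D' j) : ℝ) = q (D i) - q (D' i) := by
    rw [← Finset.sum_sub_distrib]
    refine Finset.sum_eq_single i (fun j _ hj => ?_) (by simp)
    rw [hi j hj, sub_self]
  rw [queryData, queryData, ← sub_div, hs, abs_div, Nat.abs_cast]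
  gcongr
  have h1 := (q (D i)).2
  have h2 := (q (D' i)).2
  exact abs_le.2 ⟨by linarith [h1.1, h2.2], by linarith [h1.2, h2.1]⟩

variable {n : ℕ} {Q : Finset (X → unitInterval)} {α β ε₀ : ℝ} {D D' : Fin n → X}

lemma sum_selectQuery_mul_le (rule : SelectionRule) (hn : 0 < n) (hQ : Q.Nonempty)
    (hε : 0 < ε₀) (hαβ : α.HolderConjugate β) (h : Neighboring D D') {S : Finset X} (A : Dist S)
    (g : Q → ℝ≥0∞) :
    ∑ q, selectQuery rule hQ hε.le D A q * g q ≤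
      ENNReal.ofReal (Real.exp ((α - 1) * (ε₀ ^ 2 / 2))) *
        (∑ q, selectQuery rule hQ hε.le D' A q * g q ^ β) ^ (1 / β) := by
  have : Nonempty Q := hQ.to_subtype
  have hs : ∀ D D' : Fin n → X, Neighboring D D' → ∀ q, selectQuery rule hQ hε.le D A q ≤
      ENNReal.ofReal (Real.exp ε₀) * selectQuery rule hQ hε.le D' A q := fun D D' h q => by
    have h1 := select_le rule (u := fun q : Q => |queryDist q.1 A - queryData q.1 D|)
      (u' := fun q : Q => |queryDist q.1 A - queryData q.1 D'|) (η := ε₀ * n / 2) (d := 1 / n)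
      (by positivity) (fun q => by
        refine (abs_abs_sub_abs_le_abs_sub _ _).trans ?_
        rw [sub_sub_sub_cancel_left, abs_sub_comm]
        exact abs_queryData_sub_le h q.1) q
    -- The factor `n / 2` in the exponent offsets the sensitivity `1 / n` and the doubling in
    -- `select_le`.
    have h2 : 2 * (ε₀ * n / 2 * (1 / n)) = ε₀ := by field_simp
    rwa [h2] at h1
  obtain ⟨i, hi⟩ := id h
  exact sum_mul_le_of_ratio (fun q => select_ne_zero rule _ _ q) hε hαβ (hs D D' h)
    (hs D' D ⟨i, fun j hj => (hi j hj).symm⟩) g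

lemma holderDominated_measureQuery (hn : 0 < n) (hε : 0 < ε₀) (hαβ : α.HolderConjugate β)
    (h : Neighboring D D') (q : X → unitInterval) :
    HolderDominated β (ENNReal.ofReal (Real.exp ((α - 1) * (ε₀ ^ 2 / 2))))
      (measureQuery ε₀ D q) (measureQuery ε₀ D' q) := by
  have hv : 0 < 1 / ((n : ℝ) ^ 2 * ε₀ ^ 2) := by positivity
  refine HolderDominated.map ((HolderDominated.gaussianReal hαβ _ _
    (Real.toNNReal_pos.2 hv).ne').mono ?_) measurable_clamp
  rw [Real.coe_toNNReal _ hv.le]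
  have hsq : (queryData q D - queryData q D') ^ 2 ≤ (1 / n) ^ 2 :=
    sq_le_sq' (abs_le.1 (abs_queryData_sub_le h q)).1 (abs_le.1 (abs_queryData_sub_le h q)).2
  have hle : (queryData q D - queryData q D') ^ 2 / (2 * (1 / ((n : ℝ) ^ 2 * ε₀ ^ 2))) ≤
      ε₀ ^ 2 / 2 := by
    rw [div_le_iff₀ (by positivity)]
    refine hsq.trans_eq ?_
    field_simp
  exact ENNReal.ofReal_le_ofReal
    (Real.exp_le_exp.2 (mul_le_mul_of_nonneg_left hle hαβ.sub_one_pos.le))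

/-- The step law is a mixture over the selected query, so the two costs `ε₀²/2` of selecting and
measuring add up. -/
lemma holderDominated_stepKernel (rule : SelectionRule) (hn : 0 < n) (hQ : Q.Nonempty)
    (hε : 0 < ε₀) (hαβ : α.HolderConjugate β) (h : Neighboring D D') (S : Finset X) (A : Dist S) :
    HolderDominated β (ENNReal.ofReal (Real.exp ((α - 1) * ε₀ ^ 2)))
      (stepKernel rule hQ hε.le D S A) (stepKernel rule hQ hε.le D' S A) := by
  have := HolderDominated.mixture hαβ.symm.pos
    (sum_selectQuery_mul_le rule hn hQ hε hαβ h A) fun q =>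
      (holderDominated_measureQuery hn hε hαβ h q.1).map (measurable_mwUpdate_right q.1 A)
  rw [← ENNReal.ofReal_mul (Real.exp_pos _).le, ← Real.exp_add, ← mul_add, add_halves] at this
  exact this

lemma HolderDominated.trajLaw {Y : Type*} [MeasurableSpace Y] {κ η : Kernel Y Y}
    [IsMarkovKernel κ] [IsMarkovKernel η] {K : ℝ≥0∞} (hβ : 0 < β)
    (h : ∀ y, HolderDominated β K (κ y) (η y)) (y : Y) (t : ℕ) :
    HolderDominated β (K ^ t) (PMWPub.trajLaw κ y t) (PMWPub.trajLaw η y t) := by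
  induction t with
  | zero =>
    rw [pow_zero]
    exact HolderDominated.dirac hβ _
  | succ t ih =>
    rw [pow_succ']
    exact (ih.compProd hβ fun x => h _).map (measurable_snoc t)

lemma holderDominated_pmwPub [DecidableEq X] (rule : SelectionRule) {m T : ℕ} (hn : 0 < n)
    (hm : 0 < m) (hT : 0 < T) (Dhat : Fin m → X) (hQ : Q.Nonempty) {εt : ℝ} (hεt : 0 < εt)
    (hαβ : α.HolderConjugate β) (h : Neighboring D D') :
    HolderDominated β (ENNReal.ofReal (Real.exp ((α - 1) * (1 / 2 * εt ^ 2))))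
      (pmwPub rule hm hT Dhat hQ hεt D : Measure (Dist (pubSupport Dhat)))
      (pmwPub rule hm hT Dhat hQ hεt D' : Measure (Dist (pubSupport Dhat))) := by
  have hε : 0 < epsZero εt T := by
    unfold epsZero
    positivity
  have h1 := (HolderDominated.trajLaw hαβ.symm.pos
    (holderDominated_stepKernel rule hn hQ hε hαβ h (pubSupport Dhat))
    (empirical hm Dhat) T).map (measurable_average hT)
  -- The choice `ε₀ = ε̃ / √(2T)` makes the total cost independent of `T`.
  have h2 : (T : ℝ) * ((α - 1) * epsZero εt T ^ 2) = (α - 1) * (1 / 2 * εt ^ 2) := by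
    rw [epsZero, div_pow, Real.sq_sqrt (by positivity)]
    field_simp
  rw [← ENNReal.ofReal_pow (Real.exp_pos _).le, ← Real.exp_nat_mul, h2] at h1
  exact h1

end Algorithm

/-! ### From concentrated to approximate differential privacy -/

/-- The exponential is an order isomorphism from `EReal` to `ℝ≥0∞`, so it commutes with the infimum
even at `-∞`. Privacy at the infimum thus reduces to one inequality for each `α`. -/
lemma exp_epsOfDelta_mul_add (εt δ : ℝ) {x y : ℝ≥0∞} (hx : x ≠ ∞) :
    EReal.exp (epsOfDelta εt δ) * x + y = ⨅ α : Set.Ioi (1 : ℝ),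
      (ENNReal.ofReal (Real.exp (1 / 2 * εt ^ 2 * α + Real.log (1 / (α * δ)) / (α - 1) +
        Real.log (1 - 1 / α))) * x + y) := by
  have : Nonempty (Set.Ioi (1 : ℝ)) := ⟨⟨2, Set.mem_Ioi.2 one_lt_two⟩⟩
  have h : EReal.exp (epsOfDelta εt δ) = ⨅ α : Set.Ioi (1 : ℝ),
      ENNReal.ofReal (Real.exp (1 / 2 * εt ^ 2 * α + Real.log (1 / (α * δ)) / (α - 1) +
        Real.log (1 - 1 / α))) := by
    rw [epsOfDelta, iInf_subtype']
    exact ENNReal.logOrderIso.symm.map_iInf _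
  rw [h, ENNReal.iInf_mul fun h => absurd h hx, ENNReal.iInf_add]

lemma epsOfDelta_le {εt δ : ℝ} (hεt : 0 < εt) (hδ : 0 < δ) (hδ1 : δ ≤ 1) :
    epsOfDelta εt δ ≤ ((1 / 2 * εt ^ 2 + √(2 * Real.log (1 / δ)) * εt : ℝ) : EReal) := by
  suffices h : ∃ α : ℝ, 1 < α ∧ 1 / 2 * εt ^ 2 * α + Real.log (1 / (α * δ)) / (α - 1) +
      Real.log (1 - 1 / α) ≤ 1 / 2 * εt ^ 2 + √(2 * Real.log (1 / δ)) * εt by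
    obtain ⟨α, hα, h⟩ := h
    exact (iInf₂_le α hα).trans (EReal.coe_le_coe_iff.2 h)
  have hlog : ∀ α : ℝ, 1 < α → Real.log (1 / (α * δ)) / (α - 1) ≤ Real.log (1 / δ) / (α - 1) :=
    fun α hα => by
      have := sub_pos.2 hα
      gcongr
      exact le_mul_of_one_le_left hδ.le hα.le
  have hlog1 : ∀ α : ℝ, 1 < α → Real.log (1 - 1 / α) ≤ -(1 / α) := fun α hα => by
    have h1 : 0 < 1 - 1 / α := sub_pos.2 ((div_lt_one (by linarith)).2 hα)
    linarith [Real.log_le_sub_one_of_pos h1]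
  rcases hδ1.eq_or_lt with rfl | hlt
  · set ρ := 1 / 2 * εt ^ 2 with hρ
    have hρ0 : 0 < ρ := by positivity
    have hs : 0 < 1 / (1 + ρ) := by positivity
    -- For `δ = 1` the balancing choice would be the excluded `α = 1`. Here the excess `ρ (α - 1) =
    -- ρ / (1 + ρ)` is absorbed by `log (1 - 1/α) ≤ -1/α`.
    refine ⟨1 + 1 / (1 + ρ), by linarith, ?_⟩
    have h1 := hlog (1 + 1 / (1 + ρ)) (by linarith)
    have h2 := hlog1 (1 + 1 / (1 + ρ)) (by linarith)
    have h3 : ρ * (1 / (1 + ρ)) ≤ 1 / (1 + 1 / (1 + ρ)) := by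
      rw [le_div_iff₀ (by positivity)]
      field_simp
      nlinarith
    simp only [div_one, Real.log_one, zero_div] at h1
    simp only [div_one, Real.log_one, mul_zero, Real.sqrt_zero, zero_mul, add_zero]
    linarith
  · have hl : 0 < 2 * Real.log (1 / δ) := mul_pos two_pos (Real.log_pos (one_lt_one_div hδ hlt))
    set s := √(2 * Real.log (1 / δ)) with hs
    have hs0 : 0 < s := Real.sqrt_pos.2 hl
    have hss : Real.log (1 / δ) = s ^ 2 / 2 := by
      rw [hs, Real.sq_sqrt hl.le]
      ring
    have hα : 1 < 1 + s / εt := by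
      have : 0 < s / εt := by positivity
      linarith
    -- This `α` balances `½ ε̃² (α - 1)` against `log (1/δ) / (α - 1)`: both equal `s ε̃ / 2`.
    refine ⟨1 + s / εt, hα, ?_⟩
    have h1 := hlog _ hα
    have h2 := hlog1 _ hα
    have h3 : 0 < 1 / (1 + s / εt) := by positivity
    have h4 : 1 / 2 * εt ^ 2 * (1 + s / εt) + s ^ 2 / 2 / (1 + s / εt - 1) =
        1 / 2 * εt ^ 2 + s * εt := by
      rw [add_sub_cancel_left]
      field_simp
      ring
    rw [hss] at h1
    linarith

end PMWPub

theorem mainTheorem2 {X : Type*} [DecidableEq X] {n m T : ℕ} (hn : 0 < n) (hm : 0 < m)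
    (hT : 0 < T) (Dhat : Fin m → X) {Q : Finset (X → unitInterval)} (hQ : Q.Nonempty)
    {εt : ℝ} (hεt : 0 < εt) (rule : PMWPub.SelectionRule) :
    PMWPub.IsCDP
      (fun D : Fin n → X => PMWPub.pmwPub rule hm hT Dhat hQ hεt D) (1 / 2 * εt ^ 2) ∧
    ∀ δ : ℝ, 0 < δ →
      PMWPub.IsDP
        (fun D : Fin n → X => PMWPub.pmwPub rule hm hT Dhat hQ hεt D)
        (PMWPub.epsOfDelta εt δ) δ ∧
      (δ ≤ 1 → PMWPub.epsOfDelta εt δ ≤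
        ((1 / 2 * εt ^ 2 + √(2 * Real.log (1 / δ)) * εt : ℝ) : EReal)) := by
  refine ⟨fun D D' h α hα => ?_, fun δ hδ => ⟨fun D D' h E hE => ?_,
    PMWPub.epsOfDelta_le hεt hδ⟩⟩
  · exact (PMWPub.holderDominated_pmwPub rule hn hm hT Dhat hQ hεt
      (Real.HolderConjugate.conjExponent hα) h).renyiDiv_le (Real.HolderConjugate.conjExponent hα)
  · rw [PMWPub.exp_epsOfDelta_mul_add _ _ (measure_ne_top _ _)]
    exact le_iInf fun α => (PMWPub.holderDominated_pmwPub rule hn hm hT Dhat hQ hεt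
      (Real.HolderConjugate.conjExponent α.2) h).measure_le_exp_mul_add
        (Real.HolderConjugate.conjExponent α.2) hδ hE
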